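/- For $d \ge 0$ let $Q_d$ be the $d$-dimensional hypercube graph: its vertices are the binary strings of length $d$, and two vertices are adjacent if and only if they differ in exactly one position. Let $Q_{k_1}$ and $O_{k_2}$ be subgraphs of $Q_d$ that are isomorphic to hypercubes of dimension $k_1$ and $k_2$, respectively. Let $f$ be a proper edge coloring of the subgraph $Q_{k_1} \cup O_{k_2}$ (the union of the two vertex sets and of the two edge sets) with colors from $\{1,\dots,d\}$; proper means that any two distinct edges of $Q_{k_1}\cup O_{k_2}$ with a common endpoint receive different colors. Let $A_1$ and $A_2$ be the sets of colors that $f$ uses on the edges of $Q_{k_1}$ and of $O_{k_2}$, respectively, and suppose that $|A_1| = k_1$ and $|A_2| = k_2$. Then there is a proper edge coloring of $Q_d$ with colors from $\{1,\dots,d\}$ that agrees with $f$ on every edge of $Q_{k_1} \cup O_{k_2}$, unless all of the following three conditions hold, in which case there is no such coloring: 1. $Q_{k_1}$ and $O_{k_2}$ have no vertex in common; 2. some vertex of $Q_{k_1}$ is adjacent in $Q_d$ to some vertex of $O_{k_2}$; 3. $d \le |A_1 \cup A_2|$. -/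

import Mathlib

/-- The `d`-dimensional hypercube `Q_d`: vertices are the binary strings of length `d`, and two
of them are adjacent when they differ in exactly one position. -/
def hypercube (d : ℕ) : SimpleGraph (Fin d → Bool) where
  Adj x y := hammingDist x y = 1
  symm := ⟨fun x y h => by rw [hammingDist_comm]; exact h⟩
  loopless := ⟨fun x h => by simp at h⟩

/-- A subgraph `H` of `G` is a hypercube of dimension `k` if it is isomorphic to `Q_k`. -/
def IsSubcube {V : Type*} {G : SimpleGraph V} (k : ℕ) (H : G.Subgraph) : Prop :=
  Nonempty (H.coe ≃g hypercube k)

/-- A coloring of a set `E` of edges is proper if any two distinct edges of `E` with a common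
endpoint receive different colors. -/
def IsProperEdgeColoring {V C : Type*} {E : Set (Sym2 V)} (f : E → C) : Prop :=
  ∀ e e' : E, e ≠ e' → (∃ v : V, v ∈ e.1 ∧ v ∈ e'.1) → f e ≠ f e'

/-- The set of colors that the coloring `f` of the edge set `E` uses on the edges in `S`. -/
def usedColors {V C : Type*} {E : Set (Sym2 V)} (f : E → C) (S : Set (Sym2 V)) : Set C :=
  {c | ∃ e : E, e.1 ∈ S ∧ f e = c}

/-- An edge coloring `f` of the subgraph `H` of `G` with colors from `C` is extendable if some
proper edge coloring of `G` with colors from `C` agrees with `f` on all edges of `H`. -/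
def IsExtendable {V C : Type*} {G : SimpleGraph V} {H : G.Subgraph} (f : H.edgeSet → C) : Prop :=
  ∃ g : G.edgeSet → C, IsProperEdgeColoring g ∧
    ∀ e : H.edgeSet, g ⟨e.1, H.edgeSet_subset e.2⟩ = f e

/-! Both subgraphs are subcubes: a base point and a set of free directions. A subcube colored with
as many colors as its dimension shows all of them at each of its vertices, so edges leaving it avoid
them and its inside can be recolored freely with the same colors (`IsDirColoring.recolor`). Hence
only the color sets matter: it suffices to color `Q_d` properly with colors `A` on the first cube
and `B` on the second. If the cubes meet, one permutation from directions to colors does this. If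
they are disjoint, some direction separates them. A color missing from `A ∪ B` can then be put on
that direction, with a different permutation on each side. If `A ∪ B` is everything but the cubes
are not adjacent, two directions separate them, and four permutations are glued. In the remaining
case an edge joining the two cubes has no color left. -/

/-- The vertex obtained from `x` by changing position `i`. -/
def flipAt {d : ℕ} (x : Fin d → Bool) (i : Fin d) : Fin d → Bool := Function.update x i (!x i)

lemma flipAt_same {d : ℕ} (x : Fin d → Bool) (i : Fin d) : flipAt x i i = !x i := by
  simp [flipAt]

lemma flipAt_of_ne {d : ℕ} (x : Fin d → Bool) {i j : Fin d} (h : j ≠ i) :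
    flipAt x i j = x j := by
  simp [flipAt, h]

lemma flipAt_apply {d : ℕ} (x : Fin d → Bool) (i j : Fin d) :
    flipAt x i j = if j = i then !x j else x j := by
  by_cases h : j = i
  · subst h; simp [flipAt_same]
  · simp [h, flipAt_of_ne]

lemma flipAt_flipAt {d : ℕ} (x : Fin d → Bool) (i : Fin d) : flipAt (flipAt x i) i = x := by
  funext j
  by_cases h : j = i <;> simp [flipAt_apply, h]

lemma flipAt_comm {d : ℕ} (x : Fin d → Bool) (i j : Fin d) :
    flipAt (flipAt x i) j = flipAt (flipAt x j) i := by
  funext l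
  simp only [flipAt_apply]
  split_ifs <;> rfl

lemma flipAt_injective {d : ℕ} (x : Fin d → Bool) : Function.Injective (flipAt x) := by
  intro i j h
  by_contra hij
  have := congrFun h i
  simp [flipAt_same, flipAt_of_ne x hij] at this

lemma hypercube_adj_iff {d : ℕ} {x y : Fin d → Bool} :
    (hypercube d).Adj x y ↔ ∃ i, y = flipAt x i := by
  change hammingDist x y = 1 ↔ _
  rw [hammingDist, Finset.card_eq_one]
  refine exists_congr fun i => ?_
  rw [Finset.ext_iff, funext_iff]
  refine forall_congr' fun j => ?_
  rw [flipAt_apply]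
  by_cases h : j = i
  · subst h
    cases hx : x j <;> cases hy : y j <;> simp [hx, hy]
  · cases hx : x j <;> cases hy : y j <;> simp [h, hx, hy]

lemma hypercube_adj_flipAt {d : ℕ} (x : Fin d → Bool) (i : Fin d) :
    (hypercube d).Adj x (flipAt x i) :=
  hypercube_adj_iff.2 ⟨i, rfl⟩

lemma flipAt_induction {d : ℕ} {P : (Fin d → Bool) → Prop} (h0 : P fun _ => false)
    (h : ∀ x i, P x → P (flipAt x i)) (x : Fin d → Bool) : P x := by
  have key : ∀ s : Finset (Fin d), P fun i => decide (i ∈ s) := by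
    intro s
    induction s using Finset.induction_on with
    | empty => simpa using h0
    | insert i s hi ih =>
      convert h _ i ih using 1
      funext j
      by_cases hj : j = i
      · subst hj; simp [flipAt_same, hi]
      · simp [flipAt_of_ne, hj]
  simpa using key (Finset.univ.filter fun i => x i = true)

/-- If two pairs of successive position changes lead to the same vertex, and neither starts
with the same change nor returns, then they consist of the same changes. -/
lemma eq_of_flipAt_flipAt {d : ℕ} {x : Fin d → Bool} {i j k l : Fin d} (hij : i ≠ j)
    (hik : i ≠ k) (h : flipAt (flipAt x i) j = flipAt (flipAt x k) l) : j = k := by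
  have h1 := congrFun h j
  have h2 := congrFun h i
  simp only [flipAt_apply] at h1 h2
  grind

/-! ### Isomorphic copies of hypercubes are subcubes -/

/-- Being a member of the subcube through `a` with set `S` of directions. -/
def InCube {d : ℕ} (a : Fin d → Bool) (S : Finset (Fin d)) (x : Fin d → Bool) : Prop :=
  ∀ i, i ∉ S → x i = a i

lemma InCube.flipAt {d : ℕ} {a x : Fin d → Bool} {S : Finset (Fin d)} (h : InCube a S x)
    {i : Fin d} (hi : i ∈ S) : InCube a S (flipAt x i) := by
  intro j hj
  rw [flipAt_of_ne x (by rintro rfl; exact hj hi), h j hj]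

lemma InCube.of_flipAt {d : ℕ} {a x : Fin d → Bool} {S : Finset (Fin d)} {i : Fin d}
    (h : InCube a S (_root_.flipAt x i)) (hi : i ∈ S) : InCube a S x := by
  simpa [flipAt_flipAt] using h.flipAt hi

lemma inCube_flipAt_iff {d : ℕ} {a x : Fin d → Bool} {S : Finset (Fin d)} {i : Fin d}
    (hi : i ∈ S) : InCube a S (flipAt x i) ↔ InCube a S x :=
  ⟨fun h => h.of_flipAt hi, fun h => h.flipAt hi⟩

/-- An adjacency preserving injective map between hypercubes is determined by the image of a
vertex and an injective map of directions. -/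
lemma exists_directions {k d : ℕ} {ψ : (Fin k → Bool) → Fin d → Bool}
    (hinj : Function.Injective ψ)
    (hadj : ∀ x i, (hypercube d).Adj (ψ x) (ψ (flipAt x i))) :
    ∃ σ : Fin k → Fin d, Function.Injective σ ∧
      ∀ x i, ψ (flipAt x i) = flipAt (ψ x) (σ i) := by
  choose δ hδ using fun x i => hypercube_adj_iff.1 (hadj x i)
  have hδinj : ∀ x, Function.Injective (δ x) := by
    intro x i j hij
    apply flipAt_injective x
    apply hinj
    rw [hδ, hδ, hij]
  have hconst : ∀ x i j, δ (flipAt x i) j = δ x j := by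
    intro x i j
    by_cases hij : i = j
    · subst hij
      have h := hδ (flipAt x i) i
      rw [flipAt_flipAt, hδ x i] at h
      by_contra hne
      have := congrFun h (δ x i)
      rw [flipAt_of_ne _ (Ne.symm hne), flipAt_same] at this
      simp at this
    -- The image of a 4-cycle is a 4-cycle, and its opposite sides have the same direction.
    · have h : ψ (flipAt (flipAt x i) j) = ψ (flipAt (flipAt x j) i) := by rw [flipAt_comm]
      have h1 := hδ (flipAt x i) j
      have h2 := hδ (flipAt x j) i
      rw [hδ x i] at h1
      rw [hδ x j] at h2
      refine eq_of_flipAt_flipAt ?_ (fun he => hij (hδinj x he)) (h1.symm.trans (h.trans h2))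
      intro he
      rw [← he, flipAt_flipAt] at h1
      have h3 := congrFun (hinj h1) i
      rw [flipAt_of_ne _ hij, flipAt_same] at h3
      simp at h3
  have hall : ∀ x j, δ x j = δ (fun _ => false) j := by
    intro x
    induction x using flipAt_induction with
    | h0 => exact fun _ => rfl
    | h x i ih => exact fun j => (hconst x i j).trans (ih j)
  exact ⟨δ fun _ => false, hδinj _, fun x i => by rw [hδ, hall]⟩

/-- A subgraph of a hypercube that is isomorphic to a hypercube is a subcube. -/
lemma IsSubcube.exists_inCube {d k : ℕ} {Q : (hypercube d).Subgraph} (hQ : IsSubcube k Q) :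
    ∃ (a : Fin d → Bool) (S : Finset (Fin d)), S.card = k ∧ (∀ x, x ∈ Q.verts ↔ InCube a S x) ∧
      ∀ x i, s(x, flipAt x i) ∈ Q.edgeSet ↔ InCube a S x ∧ i ∈ S := by
  obtain ⟨φ⟩ := hQ
  set ψ : (Fin k → Bool) → Fin d → Bool := fun x => (φ.symm x : Fin d → Bool) with hψ
  have hinj : Function.Injective ψ := Subtype.val_injective.comp φ.symm.injective
  have hQadj : ∀ x y, Q.Adj (ψ x) (ψ y) ↔ (hypercube k).Adj x y := fun x y => by
    rw [← φ.symm.map_adj_iff]; rfl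
  have hmem : ∀ y, y ∈ Q.verts ↔ ∃ x, ψ x = y := by
    intro y
    refine ⟨fun hy => ⟨φ ⟨y, hy⟩, by simp [hψ]⟩, ?_⟩
    rintro ⟨x, rfl⟩
    exact (φ.symm x).2
  obtain ⟨σ, hσ, hflip⟩ := exists_directions hinj
    (fun x i => Q.adj_sub ((hQadj _ _).2 (hypercube_adj_flipAt x i)))
  set a := ψ fun _ => false with ha
  have hoff : ∀ x i, (∀ j, σ j ≠ i) → ψ x i = a i := by
    intro x
    induction x using flipAt_induction with
    | h0 => exact fun _ _ => rfl
    | h x j ih =>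
      intro i hi
      rw [hflip, flipAt_of_ne _ (hi j).symm, ih i hi]
  have hon : ∀ x j, ψ x (σ j) = xor (a (σ j)) (x j) := by
    intro x
    induction x using flipAt_induction with
    | h0 => simp [ha]
    | h x i ih =>
      intro j
      rw [hflip, flipAt_apply, flipAt_apply, ih j]
      by_cases hj : j = i
      · simp [hj]
      · simp [hj, hσ.ne hj]
  have hverts : ∀ x, x ∈ Q.verts ↔ InCube a (Finset.univ.image σ) x := by
    intro y
    rw [hmem]
    constructor
    · rintro ⟨x, rfl⟩ i hi
      exact hoff x i fun j hj => hi (Finset.mem_image.2 ⟨j, Finset.mem_univ _, hj⟩)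
    · intro hy
      refine ⟨fun j => xor (a (σ j)) (y (σ j)), funext fun i => ?_⟩
      by_cases hi : ∃ j, σ j = i
      · obtain ⟨j, rfl⟩ := hi
        rw [hon]
        simp
      · push Not at hi
        rw [hoff _ _ hi, hy i (by simpa using hi)]
  refine ⟨a, Finset.univ.image σ, by simp [Finset.card_image_of_injective _ hσ], hverts, ?_⟩
  intro y i
  rw [SimpleGraph.Subgraph.mem_edgeSet, ← hverts]
  constructor
  · intro h
    refine ⟨h.fst_mem, ?_⟩
    obtain ⟨x, rfl⟩ := (hmem _).1 h.fst_mem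
    obtain ⟨x', hx'⟩ := (hmem _).1 h.snd_mem
    rw [← hx', hQadj, hypercube_adj_iff] at h
    obtain ⟨j, rfl⟩ := h
    rw [hflip] at hx'
    exact Finset.mem_image.2 ⟨j, Finset.mem_univ _, flipAt_injective _ hx'⟩
  · rintro ⟨hy, hi⟩
    obtain ⟨x, rfl⟩ := (hmem _).1 hy
    obtain ⟨j, -, rfl⟩ := Finset.mem_image.1 hi
    rw [← hflip, hQadj]
    exact hypercube_adj_flipAt x j

/-! ### Colorings by vertex and direction, and recoloring -/

/-- A proper coloring of the edges of the hypercube, where `h x i` is the color of the edge at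
`x` in direction `i`. -/
structure IsDirColoring {d : ℕ} {C : Type*} (h : (Fin d → Bool) → Fin d → C) : Prop where
  symm : ∀ x i, h (flipAt x i) i = h x i
  inj : ∀ x, Function.Injective (h x)

/-- Recoloring a subcube with the colors that it uses keeps a coloring proper. -/
lemma IsDirColoring.recolor {d : ℕ} {C : Type*} [DecidableEq C]
    {h : (Fin d → Bool) → Fin d → C} (hh : IsDirColoring h) (a : Fin d → Bool)
    (S : Finset (Fin d)) (A : Finset C) (hcard : A.card = S.card)
    (hA : ∀ x, InCube a S x → ∀ i ∈ S, h x i ∈ A)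
    {F : (Fin d → Bool) → Fin d → C} (hFs : ∀ x i, F (flipAt x i) i = F x i)
    (hFi : ∀ x, InCube a S x → Set.InjOn (F x) S)
    (hFA : ∀ x, InCube a S x → ∀ i ∈ S, F x i ∈ A)
    [∀ x i, Decidable (InCube a S x ∧ i ∈ S)] :
    IsDirColoring fun x i => if InCube a S x ∧ i ∈ S then F x i else h x i := by
  refine ⟨fun x i => ?_, fun x => ?_⟩
  · have hiff : InCube a S (flipAt x i) ∧ i ∈ S ↔ InCube a S x ∧ i ∈ S :=
      and_congr_left fun hi => inCube_flipAt_iff hi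
    simp only [hFs, hh.symm]
    exact if_congr hiff rfl rfl
  · by_cases hx : InCube a S x
    -- All of `A` is already used inside the cube at `x`, so the remaining edges at `x` cannot clash
    -- with the new colors.
    · have himg : S.image (h x) = A :=
        Finset.eq_of_subset_of_card_le (Finset.image_subset_iff.2 (hA x hx))
          (by rw [Finset.card_image_of_injective _ (hh.inj x), hcard])
      have hout : ∀ i, i ∉ S → h x i ∉ A := by
        intro i hi hiA
        rw [← himg, Finset.mem_image] at hiA
        obtain ⟨j, hj, hji⟩ := hiA
        exact hi (hh.inj x hji ▸ hj)
      intro i j hij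
      simp only [hx, true_and] at hij
      split_ifs at hij with hi hj hj
      · exact hFi x hx hi hj hij
      · exact absurd (hij ▸ hFA x hx i hi) (hout j hj)
      · exact absurd (hij ▸ hFA x hx j hj) (hout i hi)
      · exact hh.inj x hij
    · intro i j hij
      simp only [hx, false_and, if_false] at hij
      exact hh.inj x hij

lemma exists_eq_flipAt_of_mem {d : ℕ} {e : Sym2 (Fin d → Bool)} (he : e ∈ (hypercube d).edgeSet)
    {v : Fin d → Bool} (hv : v ∈ e) : ∃ i, e = s(v, flipAt v i) := by
  obtain ⟨w, rfl⟩ := Sym2.mem_iff_exists.1 hv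
  obtain ⟨i, hi⟩ := hypercube_adj_iff.1 ((SimpleGraph.mem_edgeSet _).1 he)
  exact ⟨i, by rw [hi]⟩

lemma mk_flipAt_flipAt {d : ℕ} (x : Fin d → Bool) (i : Fin d) :
    s(flipAt x i, flipAt (flipAt x i) i) = s(x, flipAt x i) := by
  rw [flipAt_flipAt, Sym2.eq_swap]

lemma mk_flipAt_inj {d : ℕ} {x y : Fin d → Bool} {i j : Fin d}
    (h : s(x, flipAt x i) = s(y, flipAt y j)) : i = j ∧ (y = x ∨ y = flipAt x i) := by
  rcases Sym2.eq_iff.1 h with ⟨rfl, h⟩ | ⟨h1, h2⟩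
  · exact ⟨flipAt_injective _ h, Or.inl rfl⟩
  · refine ⟨?_, Or.inr h2.symm⟩
    rw [← h2] at h1
    by_contra hne
    have := congrFun h1 i
    rw [flipAt_of_ne _ hne, flipAt_same] at this
    simp at this

/-- Colorings by directions give proper edge colorings of the hypercube. -/
lemma IsDirColoring.exists_edgeColoring {d : ℕ} {C : Type*} {h : (Fin d → Bool) → Fin d → C}
    (hh : IsDirColoring h) : ∃ g : (hypercube d).edgeSet → C, IsProperEdgeColoring g ∧
      ∀ x i, g ⟨s(x, flipAt x i), hypercube_adj_flipAt x i⟩ = h x i := by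
  have hex : ∀ e : (hypercube d).edgeSet, ∃ p : (Fin d → Bool) × Fin d,
      e.1 = s(p.1, flipAt p.1 p.2) := by
    rintro ⟨e, he⟩
    induction e with
    | h x y =>
      obtain ⟨i, hi⟩ := exists_eq_flipAt_of_mem he (Sym2.mem_mk_left x y)
      exact ⟨(x, i), hi⟩
  choose p hp using hex
  have hg : ∀ x i, h (p ⟨s(x, flipAt x i), hypercube_adj_flipAt x i⟩).1
      (p ⟨s(x, flipAt x i), hypercube_adj_flipAt x i⟩).2 = h x i := by
    intro x i
    obtain ⟨h1, h2 | h2⟩ := mk_flipAt_inj (hp ⟨s(x, flipAt x i), hypercube_adj_flipAt x i⟩)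
    · rw [← h1, h2]
    · rw [← h1, h2, hh.symm]
  refine ⟨fun e => h (p e).1 (p e).2, ?_, hg⟩
  rintro ⟨e, he⟩ ⟨e', he'⟩ hne ⟨v, hv, hv'⟩ heq
  obtain ⟨i, rfl⟩ := exists_eq_flipAt_of_mem he hv
  obtain ⟨j, rfl⟩ := exists_eq_flipAt_of_mem he' hv'
  have : i = j := hh.inj v (((hg v i).symm.trans heq).trans (hg v j))
  subst this
  exact hne rfl

open Classical in
/-- The colors of a coloring of some edges of the hypercube, by vertex and direction. -/
noncomputable def dirColor {d : ℕ} {E : Set (Sym2 (Fin d → Bool))} (f : E → Fin d)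
    (x : Fin d → Bool) (i : Fin d) : Fin d :=
  -- The default must not depend on `x`, so that both ends of an edge give the same value.
  if h : s(x, flipAt x i) ∈ E then f ⟨_, h⟩ else i

lemma dirColor_eq {d : ℕ} {E : Set (Sym2 (Fin d → Bool))} (f : E → Fin d) {x : Fin d → Bool}
    {i : Fin d} (h : s(x, flipAt x i) ∈ E) : dirColor f x i = f ⟨_, h⟩ := by
  simp [dirColor, h]

lemma dirColor_flipAt {d : ℕ} {E : Set (Sym2 (Fin d → Bool))} (f : E → Fin d)
    (x : Fin d → Bool) (i : Fin d) : dirColor f (flipAt x i) i = dirColor f x i := by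
  classical
  have key : ∀ e e' : Sym2 (Fin d → Bool), e = e' →
      (if h : e ∈ E then f ⟨e, h⟩ else i) = if h : e' ∈ E then f ⟨e', h⟩ else i := by
    rintro e _ rfl
    rfl
  convert key _ _ (mk_flipAt_flipAt x i) using 1 <;> unfold dirColor <;> congr

lemma IsProperEdgeColoring.eq_of_dirColor_eq {d : ℕ} {E : Set (Sym2 (Fin d → Bool))}
    {f : E → Fin d} (hf : IsProperEdgeColoring f) {x : Fin d → Bool} {i j : Fin d}
    (hi : s(x, flipAt x i) ∈ E) (hj : s(x, flipAt x j) ∈ E)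
    (h : dirColor f x i = dirColor f x j) : i = j := by
  by_contra hne
  rw [dirColor_eq f hi, dirColor_eq f hj] at h
  refine hf ⟨_, hi⟩ ⟨_, hj⟩ (fun he => ?_) ⟨x, Sym2.mem_mk_left _ _, Sym2.mem_mk_left _ _⟩ h
  exact hne (mk_flipAt_inj (congrArg Subtype.val he)).1

/-! ### Permutations and colorings with prescribed color sets -/

/-- There is a permutation that maps each of two sets into prescribed sets with the same
cardinalities and the same cardinality of the intersection. -/
lemma exists_perm_maps_two {α : Type*} [Fintype α] [DecidableEq α] (S T A B : Finset α)
    (hS : S.card = A.card) (hT : T.card = B.card) (hST : (S ∩ T).card = (A ∩ B).card) :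
    ∃ φ : Equiv.Perm α, (∀ i ∈ S, φ i ∈ A) ∧ ∀ i ∈ T, φ i ∈ B := by
  -- The four cells cut out by `S` and `T` have the sizes of those cut out by `A` and `B`;
  -- bijections between cells are glued.
  have hfib : ∀ c : Prop × Prop, Nonempty
      ({i : α // (i ∈ S, i ∈ T) = c} ≃ {i : α // (i ∈ A, i ∈ B) = c}) := by
    classical
    rintro ⟨p, q⟩
    rw [← Fintype.card_eq, Fintype.card_subtype, Fintype.card_subtype]
    have h1 : ∀ S T : Finset α, (S \ T).card + (S ∩ T).card = S.card := fun S T =>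
      Finset.card_sdiff_add_card_inter S T
    have h2 := h1 S T
    have h3 := h1 A B
    have h4 := h1 T S
    have h5 := h1 B A
    rw [Finset.inter_comm] at h4 h5
    have h6 := Finset.card_compl_add_card (S ∪ T)
    have h7 := Finset.card_compl_add_card (A ∪ B)
    have h8 := Finset.card_union_add_card_inter S T
    have h9 := Finset.card_union_add_card_inter A B
    have e : ∀ S T : Finset α, (Finset.univ.filter fun i => (i ∈ S, i ∈ T) = (p, q)).card =
        if p then (if q then (S ∩ T).card else (S \ T).card)
        else (if q then (T \ S).card else ((S ∪ T)ᶜ).card) := by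
      intro S T
      by_cases hp : p <;> by_cases hq : q <;> simp only [hp, hq, if_true, if_false] <;>
        (congr 1; ext i; simp; try tauto)
    rw [e, e]
    split_ifs <;> omega
  have E := fun c => (hfib c).some
  refine ⟨Equiv.ofFiberEquiv E, fun i hi => ?_, fun i hi => ?_⟩
  · exact (congrArg Prod.fst (Equiv.ofFiberEquiv_map E i)).mpr hi
  · exact (congrArg Prod.snd (Equiv.ofFiberEquiv_map E i)).mpr hi

lemma exists_perm_maps_set_point {α : Type*} [Fintype α] [DecidableEq α] {S A : Finset α}
    (hS : S.card = A.card) {j c : α} (hj : j ∉ S) (hc : c ∉ A) :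
    ∃ φ : Equiv.Perm α, (∀ i ∈ S, φ i ∈ A) ∧ φ j = c := by
  obtain ⟨φ, h1, h2⟩ := exists_perm_maps_two S {j} A {c} hS rfl (by simp [hj, hc])
  exact ⟨φ, h1, by simpa using h2⟩

lemma exists_perm_maps_set_points {α : Type*} [Fintype α] [DecidableEq α] {S A : Finset α}
    (hS : S.card = A.card) {j j' c c' : α} (hj : j ∉ S) (hj' : j' ∉ S) (hjj : j ≠ j')
    (hc : c ∉ A) (hc' : c' ∉ A) (hcc : c ≠ c') :
    ∃ φ : Equiv.Perm α, (∀ i ∈ S, φ i ∈ A) ∧ φ j = c ∧ φ j' = c' := by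
  obtain ⟨φ, h1, h2⟩ := exists_perm_maps_set_point (S := insert j S) (A := insert c A)
    (by simp [hj, hc, hS]) (j := j') (c := c') (by simp [hj', hjj.symm]) (by simp [hc', hcc.symm])
  -- Swapping `φ j` with `c` corrects the value at `j` and leaves `c'` in place.
  have hφ : φ.trans (Equiv.swap (φ j) c) j' = c' := by
    rw [Equiv.trans_apply, h2, Equiv.swap_apply_of_ne_of_ne _ hcc.symm]
    rw [← h2]
    exact φ.injective.ne hjj.symm
  refine ⟨φ.trans (Equiv.swap (φ j) c), fun i hi => ?_, by simp, hφ⟩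
  have hij : i ≠ j := by rintro rfl; exact hj hi
  have hi' := Finset.mem_insert.1 (h1 i (Finset.mem_insert_of_mem hi))
  rw [Equiv.trans_apply]
  rcases hi' with hi' | hi'
  · rw [hi', Equiv.swap_apply_right]
    refine (Finset.mem_insert.1 (h1 j (Finset.mem_insert_self _ _))).resolve_left fun h => ?_
    exact hij (φ.injective (hi'.trans h.symm))
  · rwa [Equiv.swap_apply_of_ne_of_ne (φ.injective.ne hij) (by rintro h; exact hc (h ▸ hi'))]

/-- Two subcubes that are separated by a direction can be given any two color sets of the right
cardinalities that miss a common color. -/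
lemma exists_isDirColoring_of_missing {d : ℕ} {a b : Fin d → Bool} {S T A B : Finset (Fin d)}
    (hS : S.card = A.card) (hT : T.card = B.card) {j c : Fin d} (hjS : j ∉ S) (hjT : j ∉ T)
    (hj : a j ≠ b j) (hcA : c ∉ A) (hcB : c ∉ B) :
    ∃ h : (Fin d → Bool) → Fin d → Fin d, IsDirColoring h ∧
      (∀ x, InCube a S x → ∀ i ∈ S, h x i ∈ A) ∧ ∀ x, InCube b T x → ∀ i ∈ T, h x i ∈ B := by
  obtain ⟨φ, hφA, hφ⟩ := exists_perm_maps_set_point hS hjS hcA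
  obtain ⟨χ, hχB, hχ⟩ := exists_perm_maps_set_point hT hjT hcB
  -- Edges in direction `j` cross between the halves; both permutations give them `c`.
  refine ⟨fun x i => if x j = a j then φ i else χ i, ⟨fun x i => ?_, fun x => ?_⟩, ?_, ?_⟩
  · by_cases hij : j = i
    · subst hij; simp [hφ, hχ]
    · simp [flipAt_of_ne x hij]
  · by_cases hx : x j = a j
    · simpa [hx] using φ.injective
    · simpa [hx] using χ.injective
  · intro x hx i hi
    simpa [hx j hjS] using hφA i hi
  · intro x hx i hi
    simpa [hx j hjT, hj.symm] using hχB i hi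

/-- Two subcubes that are separated by two directions can be given any two color sets of the
right cardinalities that together contain all colors. -/
lemma exists_isDirColoring_of_union_eq {d : ℕ} {a b : Fin d → Bool} {S T A B : Finset (Fin d)}
    (hS : S.card = A.card) (hT : T.card = B.card) {j l : Fin d} (hjl : j ≠ l)
    (hjS : j ∉ S) (hjT : j ∉ T) (hj : a j ≠ b j) (hlS : l ∉ S) (hlT : l ∉ T) (hl : a l ≠ b l)
    (hAB : ∀ c, c ∈ A ∨ c ∈ B) :
    ∃ h : (Fin d → Bool) → Fin d → Fin d, IsDirColoring h ∧
      (∀ x, InCube a S x → ∀ i ∈ S, h x i ∈ A) ∧ ∀ x, InCube b T x → ∀ i ∈ T, h x i ∈ B := by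
  have hmiss : ∀ {S A : Finset (Fin d)}, S.card = A.card → j ∉ S → l ∉ S →
      ∃ c c', c ∉ A ∧ c' ∉ A ∧ c ≠ c' := by
    intro S A hS hjS hlS
    have : 1 < Aᶜ.card := by
      rw [Finset.card_compl, ← hS, ← Finset.card_compl]
      exact Finset.one_lt_card.2 ⟨j, by simpa, l, by simpa, hjl⟩
    obtain ⟨c, hc, c', hc', hne⟩ := Finset.one_lt_card.1 this
    exact ⟨c, c', by simpa using hc, by simpa using hc', hne⟩
  obtain ⟨p, q, hp, hq, hpq⟩ := hmiss hS hjS hlS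
  obtain ⟨r, s, hr, hs, hrs⟩ := hmiss hT hjT hlT
  -- No color is missing from both `A` and `B`.
  have hps : p ≠ s := by rintro rfl; exact (hAB p).elim hp hs
  have hqr : q ≠ r := by rintro rfl; exact (hAB q).elim hq hr
  obtain ⟨φ, hφA, hφj, hφl⟩ := exists_perm_maps_set_points hS hjS hlS hjl hp hq hpq
  obtain ⟨χ, hχB, hχj, hχl⟩ := exists_perm_maps_set_points hT hjT hlT hjl hr hs hrs
  obtain ⟨μ, -, hμj, hμl⟩ := exists_perm_maps_set_points (S := ∅) (A := ∅) rfl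
    (Finset.notMem_empty j) (Finset.notMem_empty l) hjl (Finset.notMem_empty p)
    (Finset.notMem_empty s) hps
  obtain ⟨ν, -, hνj, hνl⟩ := exists_perm_maps_set_points (S := ∅) (A := ∅) rfl
    (Finset.notMem_empty j) (Finset.notMem_empty l) hjl (Finset.notMem_empty r)
    (Finset.notMem_empty q) hqr.symm
  -- Permutations on neighboring quarters must agree on the direction crossed: `φ` and `μ` on `j`,
  -- `φ` and `ν` on `l`, `ν` and `χ` on `j`, `μ` and `χ` on `l`.
  refine ⟨fun x i => if x j = a j then (if x l = a l then φ i else ν i)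
    else (if x l = a l then μ i else χ i), ⟨fun x i => ?_, fun x => ?_⟩, ?_, ?_⟩
  · by_cases hji : j = i
    · subst hji
      simp [flipAt_of_ne x hjl.symm, hφj, hχj, hμj, hνj]
    · by_cases hli : l = i
      · subst hli
        simp [flipAt_of_ne x hji, hφl, hχl, hμl, hνl]
      · simp [flipAt_of_ne x hji, flipAt_of_ne x hli]
  · by_cases hx : x j = a j <;> by_cases hx' : x l = a l
    · simpa [hx, hx'] using φ.injective
    · simpa [hx, hx'] using ν.injective
    · simpa [hx, hx'] using μ.injective
    · simpa [hx, hx'] using χ.injective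
  · intro x hx i hi
    simpa [hx j hjS, hx l hlS] using hφA i hi
  · intro x hx i hi
    simpa [hx j hjT, hx l hlT, hj.symm, hl.symm] using hχB i hi

/-- Otherwise the point equal to `b` on `S` and to `a` elsewhere lies in both cubes. -/
lemma exists_separating_direction {d : ℕ} {a b : Fin d → Bool} {S T : Finset (Fin d)}
    (h : ∀ x, InCube a S x → ¬ InCube b T x) : ∃ j, j ∉ S ∧ j ∉ T ∧ a j ≠ b j := by
  by_contra! hj
  refine h (fun i => if i ∈ S then b i else a i) (fun i hi => by simp [hi]) fun i hi => ?_
  by_cases hiS : i ∈ S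
  · simp [hiS]
  · simp [hiS, hj i hiS hi]

/-- If `j` were the only separating direction, flipping `j` at that same point of the first cube
would lead into the second. -/
lemma exists_second_separating_direction {d : ℕ} {a b : Fin d → Bool} {S T : Finset (Fin d)}
    (h : ∀ x, InCube a S x → ∀ i, ¬ InCube b T (flipAt x i)) {j : Fin d} (hjS : j ∉ S)
    (hj : a j ≠ b j) :
    ∃ l, j ≠ l ∧ l ∉ S ∧ l ∉ T ∧ a l ≠ b l := by
  by_contra! hl
  refine h (fun i => if i ∈ S then b i else a i) (fun i hi => by simp [hi]) j fun i hi => ?_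
  by_cases hij : i = j
  · subst hij
    rw [flipAt_same]
    simp only [hjS, if_false]
    cases h1 : a i <;> cases h2 : b i <;> simp_all
  · rw [flipAt_of_ne _ hij]
    by_cases hiS : i ∈ S
    · simp [hiS]
    · simp [hiS, hl i (Ne.symm hij) hiS hi]

/-! ### Extending the given coloring -/

/-- If some proper coloring of the hypercube uses only the colors of `f` on each of the two
subcubes, then `f` is extendable. -/
lemma isExtendable_of_isDirColoring {d : ℕ} {Q O : (hypercube d).Subgraph}
    {f : (Q ⊔ O).edgeSet → Fin d} {a b : Fin d → Bool} {S T A B : Finset (Fin d)}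
    (hf : IsProperEdgeColoring f)
    (hQ : ∀ x i, s(x, flipAt x i) ∈ Q.edgeSet ↔ InCube a S x ∧ i ∈ S)
    (hO : ∀ x i, s(x, flipAt x i) ∈ O.edgeSet ↔ InCube b T x ∧ i ∈ T)
    (hS : S.card = A.card) (hT : T.card = B.card)
    (hA : ∀ x, InCube a S x → ∀ i ∈ S, dirColor f x i ∈ A)
    (hB : ∀ x, InCube b T x → ∀ i ∈ T, dirColor f x i ∈ B)
    {h : (Fin d → Bool) → Fin d → Fin d} (hh : IsDirColoring h)
    (hhA : ∀ x, InCube a S x → ∀ i ∈ S, h x i ∈ A)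
    (hhB : ∀ x, InCube b T x → ∀ i ∈ T, h x i ∈ B) : IsExtendable f := by
  classical
  have hE : (Q ⊔ O).edgeSet = Q.edgeSet ∪ O.edgeSet := SimpleGraph.Subgraph.edgeSet_sup
  have hQE : ∀ x, InCube a S x → ∀ i ∈ S, s(x, flipAt x i) ∈ (Q ⊔ O).edgeSet :=
    fun x hx i hi => hE ▸ Or.inl ((hQ x i).2 ⟨hx, hi⟩)
  have hOE : ∀ x, InCube b T x → ∀ i ∈ T, s(x, flipAt x i) ∈ (Q ⊔ O).edgeSet :=
    fun x hx i hi => hE ▸ Or.inr ((hO x i).2 ⟨hx, hi⟩)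
  have h1 := hh.recolor b T B hT.symm hhB (dirColor_flipAt f)
    (fun x hx i hi j hj hij => hf.eq_of_dirColor_eq (hOE x hx i hi) (hOE x hx j hj) hij) hB
  have h2 := h1.recolor a S A hS.symm
    -- On edges common to both cubes the first recoloring already put the colors of `f`, which lie
    -- in `A`.
    (fun x hx i hi => by
      split_ifs
      · exact hA x hx i hi
      · exact hhA x hx i hi)
    (dirColor_flipAt f)
    (fun x hx i hi j hj hij => hf.eq_of_dirColor_eq (hQE x hx i hi) (hQE x hx j hj) hij) hA
  obtain ⟨g, hg, hgh⟩ := h2.exists_edgeColoring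
  refine ⟨g, hg, ?_⟩
  rintro ⟨e, he⟩
  have he' := (Q ⊔ O).edgeSet_subset he
  induction e with
  | h x y =>
    obtain ⟨i, hi⟩ := exists_eq_flipAt_of_mem he' (Sym2.mem_mk_left x y)
    obtain rfl : y = flipAt x i := Sym2.congr_right.1 hi
    rw [hgh, ← dirColor_eq f he]
    have he2 := he
    rw [hE, Set.mem_union, hQ, hO] at he2
    rcases he2 with he2 | he2 <;> simp [he2]

/-- At a vertex of a subcube, a proper coloring uses all its colors if their number is the
dimension. -/
lemma image_dirColor_eq {d : ℕ} {E : Set (Sym2 (Fin d → Bool))} {f : E → Fin d}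
    {x : Fin d → Bool} {S A : Finset (Fin d)} (hf : IsProperEdgeColoring f)
    (hE : ∀ i ∈ S, s(x, flipAt x i) ∈ E) (hA : ∀ i ∈ S, dirColor f x i ∈ A)
    (hS : S.card = A.card) : S.image (dirColor f x) = A := by
  refine Finset.eq_of_subset_of_card_le (Finset.image_subset_iff.2 hA) ?_
  rw [Finset.card_image_of_injOn, hS]
  exact fun i hi j hj hij => hf.eq_of_dirColor_eq (hE i hi) (hE j hj) hij

theorem mainTheorem3 (d k₁ k₂ : ℕ) (Q O : (hypercube d).Subgraph)
    (hQ : IsSubcube k₁ Q) (hO : IsSubcube k₂ O)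
    (f : (Q ⊔ O).edgeSet → Fin d) (hf : IsProperEdgeColoring f)
    (A₁ A₂ : Set (Fin d))
    (hA₁ : A₁ = usedColors f Q.edgeSet) (hA₂ : A₂ = usedColors f O.edgeSet)
    (hk₁ : A₁.ncard = k₁) (hk₂ : A₂.ncard = k₂) :
    IsExtendable f ↔
      ¬ (Disjoint Q.verts O.verts ∧
        (∃ u ∈ Q.verts, ∃ v ∈ O.verts, (hypercube d).Adj u v) ∧
        d ≤ (A₁ ∪ A₂).ncard) := by
  classical
  obtain ⟨a, S, hS, hQv, hQe⟩ := hQ.exists_inCube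
  obtain ⟨b, T, hT, hOv, hOe⟩ := hO.exists_inCube
  obtain ⟨A, rfl⟩ : ∃ A : Finset (Fin d), A₁ = A := ⟨A₁.toFinset, by simp⟩
  obtain ⟨B, rfl⟩ : ∃ B : Finset (Fin d), A₂ = B := ⟨A₂.toFinset, by simp⟩
  rw [Set.ncard_coe_finset] at hk₁ hk₂
  replace hS : S.card = A.card := hS.trans hk₁.symm
  replace hT : T.card = B.card := hT.trans hk₂.symm
  have hE : (Q ⊔ O).edgeSet = Q.edgeSet ∪ O.edgeSet := SimpleGraph.Subgraph.edgeSet_sup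
  have hQE : ∀ x, InCube a S x → ∀ i ∈ S, s(x, flipAt x i) ∈ (Q ⊔ O).edgeSet :=
    fun x hx i hi => hE ▸ Or.inl ((hQe x i).2 ⟨hx, hi⟩)
  have hOE : ∀ x, InCube b T x → ∀ i ∈ T, s(x, flipAt x i) ∈ (Q ⊔ O).edgeSet :=
    fun x hx i hi => hE ▸ Or.inr ((hOe x i).2 ⟨hx, hi⟩)
  have hA : ∀ x, InCube a S x → ∀ i ∈ S, dirColor f x i ∈ A := fun x hx i hi => by
    rw [← Finset.mem_coe, hA₁, dirColor_eq f (hQE x hx i hi)]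
    exact ⟨_, (hQe x i).2 ⟨hx, hi⟩, rfl⟩
  have hB : ∀ x, InCube b T x → ∀ i ∈ T, dirColor f x i ∈ B := fun x hx i hi => by
    rw [← Finset.mem_coe, hA₂, dirColor_eq f (hOE x hx i hi)]
    exact ⟨_, (hOe x i).2 ⟨hx, hi⟩, rfl⟩
  have himA : ∀ x, InCube a S x → S.image (dirColor f x) = A := fun x hx =>
    image_dirColor_eq hf (hQE x hx) (hA x hx) hS
  have himB : ∀ x, InCube b T x → T.image (dirColor f x) = B := fun x hx =>
    image_dirColor_eq hf (hOE x hx) (hB x hx) hT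
  have hcov : d ≤ ((A : Set (Fin d)) ∪ B).ncard ↔ ∀ c, c ∈ A ∨ c ∈ B := by
    rw [← Finset.coe_union, Set.ncard_coe_finset]
    constructor
    · intro h c
      have : A ∪ B = Finset.univ :=
        Finset.eq_univ_of_card _ (le_antisymm (Finset.card_le_univ _) (by simpa using h))
      rw [← Finset.mem_union, this]
      exact Finset.mem_univ c
    · intro h
      rw [Finset.eq_univ_of_forall fun c => Finset.mem_union.2 (h c), Finset.card_univ,
        Fintype.card_fin]
  rw [hcov, Set.disjoint_left]
  simp only [hQv, hOv]
  constructor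
  · rintro ⟨g, hg, hgf⟩ ⟨hdisj, ⟨u, hu, v, hv, huv⟩, hc⟩
    have key : ∀ x i j, s(x, flipAt x j) ∈ (Q ⊔ O).edgeSet →
        dirColor f x j = dirColor g x i → j = i := by
      intro x i j hj h
      have hj' := (Q ⊔ O).edgeSet_subset hj
      rw [dirColor_eq f hj, ← hgf, ← dirColor_eq g hj'] at h
      exact hg.eq_of_dirColor_eq hj' (hypercube_adj_flipAt x i) h
    obtain ⟨i, rfl⟩ := hypercube_adj_iff.1 huv
    -- The color of the joining edge already occurs at one of its ends on an edge of the cube there.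
    -- By properness these edges coincide, so the other end lies in that cube too.
    rcases hc (dirColor g u i) with h | h
    · rw [← himA u hu, Finset.mem_image] at h
      obtain ⟨j, hj, hji⟩ := h
      obtain rfl := key u i j (hQE u hu j hj) hji
      exact hdisj (hu.flipAt hj) hv
    · rw [← himB _ hv, ← dirColor_flipAt, Finset.mem_image] at h
      obtain ⟨j, hj, hji⟩ := h
      obtain rfl := key _ i j (hOE _ hv j hj) hji
      exact hdisj hu (hv.of_flipAt hj)
  · intro hnot
    suffices ∃ h : (Fin d → Bool) → Fin d → Fin d, IsDirColoring h ∧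
        (∀ x, InCube a S x → ∀ i ∈ S, h x i ∈ A) ∧ ∀ x, InCube b T x → ∀ i ∈ T, h x i ∈ B by
      obtain ⟨h, hh, hhA, hhB⟩ := this
      exact isExtendable_of_isDirColoring hf hQe hOe hS hT hA hB hh hhA hhB
    by_cases hdisj : ∀ ⦃x⦄, InCube a S x → ¬ InCube b T x
    · obtain ⟨j, hjS, hjT, hj⟩ := exists_separating_direction hdisj
      by_cases hc : ∀ c, c ∈ A ∨ c ∈ B
      · obtain ⟨l, hjl, hlS, hlT, hl⟩ := exists_second_separating_direction (a := a) (b := b)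
          (S := S) (T := T)
          (fun x hx i hi => hnot ⟨hdisj, ⟨x, hx, _, hi, hypercube_adj_flipAt x i⟩, hc⟩) hjS hj
        exact exists_isDirColoring_of_union_eq hS hT hjl hjS hjT hj hlS hlT hl hc
      · push Not at hc
        obtain ⟨c, hcA, hcB⟩ := hc
        exact exists_isDirColoring_of_missing hS hT hjS hjT hj hcA hcB
    · push Not at hdisj
      obtain ⟨x, hxQ, hxO⟩ := hdisj
      have hinj : Set.InjOn (dirColor f x) ((S : Set (Fin d)) ∪ T) := by
        have hmem : ∀ i ∈ (S : Set (Fin d)) ∪ T, s(x, flipAt x i) ∈ (Q ⊔ O).edgeSet :=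
          fun i hi => hi.elim (hQE x hxQ i) (hOE x hxO i)
        exact fun i hi j hj hij => hf.eq_of_dirColor_eq (hmem i hi) (hmem j hj) hij
      -- At the common vertex `x` the coloring is injective on `S ∪ T`, so it maps `S ∩ T`
      -- bijectively onto `A ∩ B`.
      obtain ⟨φ, hφA, hφB⟩ := exists_perm_maps_two S T A B hS hT (by
        rw [← himA x hxQ, ← himB x hxO, ← Finset.image_inter_of_injOn _ _ hinj]
        refine (Finset.card_image_of_injOn (hinj.mono ?_)).symm
        intro i hi
        exact Or.inl (Finset.mem_inter.1 (Finset.mem_coe.1 hi)).1)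
      exact ⟨fun _ => φ, ⟨fun _ _ => rfl, fun _ => φ.injective⟩, fun _ _ => hφA,
        fun _ _ => hφB⟩
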